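/- Let $p\ge 0$ be an integer and $\beta\in(0,1)$. Let $R(\xi,\xi')\ge 0$, $\xi\neq\xi'$, be the jump rates of an irreducible continuous-time Markov chain on $\Omega^*_p=\{0,1\}^{\{-p,\dots,0\}}$, with generator $(L_l f)(\xi)=\sum_{\xi'}R(\xi,\xi')\,[f(\xi')-f(\xi)]$. Let $(\ell_N)_{N\ge 2}$ be a sequence of positive real numbers with $\ell_N\to\infty$. For $N\ge 2$ consider the Markov chain on $\Omega_{N,p}=\{0,1\}^{\{-p,\dots,N-1\}}$ with generator $$L_N=\ell_N\,L_l+L_{0,1}+L_{b,N}+L_{r,N},$$ where $L_l$ acts on the coordinates $(\eta_{-p},\dots,\eta_0)$ and $$(L_{0,1}f)(\eta)=f(\sigma^{0,1}\eta)-f(\eta),\qquad (L_{b,N}f)(\eta)=\sum_{k=1}^{N-2}\{f(\sigma^{k,k+1}\eta)-f(\eta)\},$$ $$(L_{r,N}f)(\eta)=\{\beta(1-\eta_{N-1})+(1-\beta)\eta_{N-1}\}\,\{f(\sigma^{N-1}\eta)-f(\eta)\}.$$ Here $\sigma^{j,k}\eta$ is obtained from $\eta$ by exchanging $\eta_j$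 and $\eta_k$, and $\sigma^{k}\eta$ by replacing $\eta_k$ with $1-\eta_k$. Then the chain with generator $L_l$ has a unique stationary state $\mu$, and, for every $N\ge 2$, the chain with generator $L_N$ has a unique stationary state $\mu_N$. Let $\rho(0)=E_\mu[\eta_0]$ and $\rho_N(0)=E_{\mu_N}[\eta_0]$. There exists a finite constant $C_0$, independent of $N$, such that $$|\rho_N(0)-\rho(0)|\le \frac{C_0}{\sqrt{\ell_N}}\qquad\text{for all } N\ge 2.$$ Moreover, the boundary value problem $\Delta u=0$ on $(0,1)$, $u(0)=\rho(0)$, $u(1)=\beta$, has a unique solution $\bar u\in C([0,1])\cap C^2((0,1))$, and for every continuous function $G:[0,1]\to\mathbb R$, $$\lim_{N\to\infty}E_{\mu_N}\Big[\,\Big|\frac1N\sum_{k=1}^{N-1}G(k/N)\,[\eta_k-\bar u(k/N)]\Big|\,\Big]=0.$$ -/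

import Mathlib

open Filter Topology

noncomputable section

namespace BoundaryExclusion

/-- Configurations of particles on a finite set `Λ` of integer sites (`true` = occupied). -/
abbrev Config (Λ : Finset ℤ) : Type := Λ → Bool

/-- The left boundary sites `{-p, …, 0}`. -/
abbrev leftSites (p : ℕ) : Finset ℤ := Finset.Icc (-(p : ℤ)) 0

/-- All the sites `{-p, …, N - 1}` of the boundary driven system. -/
abbrev sites (p N : ℕ) : Finset ℤ := Finset.Icc (-(p : ℤ)) ((N : ℤ) - 1)

/-- The state of site `k` in the configuration `η`; the default `false` is only used off `Λ`. -/
def stateAt {Λ : Finset ℤ} (η : Config Λ) (k : ℤ) : Bool :=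
  if h : k ∈ Λ then η ⟨k, h⟩ else false

/-- The occupation variable `η_k ∈ {0, 1}`, as a real number. -/
def occ {Λ : Finset ℤ} (η : Config Λ) (k : ℤ) : ℝ :=
  if stateAt η k = true then 1 else 0

/-- The configuration `σ^{j,k} η`: the states of the sites `j` and `k` are exchanged. -/
def exchange {Λ : Finset ℤ} (j k : ℤ) (η : Config Λ) : Config Λ :=
  fun s => stateAt η (Equiv.swap j k (s : ℤ))

/-- The configuration `σ^k η`: the state of the site `k` is flipped. -/
def flipAt {Λ : Finset ℤ} (k : ℤ) (η : Config Λ) : Config Λ :=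
  fun s => if (s : ℤ) = k then !(η s) else η s

/-- The restriction of a configuration on `{-p, …, N - 1}`, `N ≥ 1`, to `{-p, …, 0}`. -/
def leftPart {p N : ℕ} (η : Config (sites p N)) : Config (leftSites p) :=
  fun s => stateAt η (s : ℤ)

/-- The configuration which equals `ξ` on `{-p, …, 0}` and `η` on `{1, …, N - 1}`. -/
def replaceLeft {p N : ℕ} (ξ : Config (leftSites p)) (η : Config (sites p N)) :
    Config (sites p N) :=
  fun s => if (s : ℤ) ≤ 0 then stateAt ξ (s : ℤ) else η s

/-- The generator of the continuous-time Markov chain on a finite set `S` which jumps from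
`s` to `t ≠ s` at rate `R s t` (the diagonal of `R` plays no role). -/
def chainGen {S : Type*} [Fintype S] (R : S → S → ℝ) (f : S → ℝ) (s : S) : ℝ :=
  ∑ t, R s t * (f t - f s)

/-- Irreducibility of the chain with jump rates `R`: any state can be reached from any other
one through jumps of positive rate. -/
def IsIrreducibleChain {S : Type*} (R : S → S → ℝ) : Prop :=
  ∀ s t, Relation.ReflTransGen (fun a b => 0 < R a b) s t

/-- The expectation of `f` under the probability weights `μ`. -/
def expect {S : Type*} [Fintype S] (μ : S → ℝ) (f : S → ℝ) : ℝ :=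
  ∑ s, μ s * f s

/-- `μ` is a stationary state (stationary probability) of the Markov chain on the finite set
`S` with generator `L`: it is a probability vector and `E_μ[L f] = 0` for all `f`. -/
def IsStationary {S : Type*} [Fintype S] (L : (S → ℝ) → S → ℝ) (μ : S → ℝ) : Prop :=
  μ ∈ stdSimplex ℝ S ∧ ∀ f : S → ℝ, expect μ (L f) = 0

/-- The density `E_μ[η_k]` at the site `k`. -/
def density {Λ : Finset ℤ} (μ : Config Λ → ℝ) (k : ℤ) : ℝ :=
  expect μ fun η => occ η k

/-- The left boundary chain with jump rates `R`, acting on functions on the full space. -/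
def leftGen {p : ℕ} (N : ℕ) (R : Config (leftSites p) → Config (leftSites p) → ℝ)
    (f : Config (sites p N) → ℝ) (η : Config (sites p N)) : ℝ :=
  ∑ ξ : Config (leftSites p), R (leftPart η) ξ * (f (replaceLeft ξ η) - f η)

/-- The stirring dynamics between the sites `0` and `1`. -/
def junctionGen {p N : ℕ} (f : Config (sites p N) → ℝ) (η : Config (sites p N)) : ℝ :=
  f (exchange 0 1 η) - f η

/-- The symmetric simple exclusion process on `{1, …, N - 1}`, reflected at the ends. -/
def bulkGen {p N : ℕ} (f : Config (sites p N) → ℝ) (η : Config (sites p N)) : ℝ :=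
  ∑ k ∈ Finset.Icc (1 : ℤ) ((N : ℤ) - 2), (f (exchange k (k + 1) η) - f η)

/-- The right reservoir at density `β`, acting on the site `N - 1`. -/
def rightGen {p N : ℕ} (β : ℝ) (f : Config (sites p N) → ℝ) (η : Config (sites p N)) : ℝ :=
  (β * (1 - occ η ((N : ℤ) - 1)) + (1 - β) * occ η ((N : ℤ) - 1)) *
    (f (flipAt ((N : ℤ) - 1) η) - f η)

/-- The generator of the full process; the left boundary dynamics is speeded up by `l`. -/
def fullGen {p : ℕ} (N : ℕ) (R : Config (leftSites p) → Config (leftSites p) → ℝ) (l β : ℝ)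
    (f : Config (sites p N) → ℝ) (η : Config (sites p N)) : ℝ :=
  l * leftGen N R f η + junctionGen f η + bulkGen f η + rightGen β f η

/-- `u` solves `Δ u = 0` on `(0, 1)` with the boundary conditions `u(0) = a`, `u(1) = b`. -/
structure SolvesDirichlet (a b : ℝ) (u : ℝ → ℝ) : Prop where
  continuousOn : ContinuousOn u (Set.Icc 0 1)
  contDiffOn : ContDiffOn ℝ 2 u (Set.Ioo 0 1)
  laplace : ∀ x ∈ Set.Ioo (0 : ℝ) 1, iteratedDeriv 2 u x = 0
  left : u 0 = a
  right : u 1 = b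

end BoundaryExclusion

end

open BoundaryExclusion

namespace BoundaryExclusion

/-! ### Finite generators -/

section FiniteGenerator

variable {S : Type*} [Fintype S]

/-! Let `h` solve the Poisson equation of the left chain, `L_l h = ξ_0 - ρ(0)`. Testing the
stationarity of `μ_N` against `h(η_{-p}, …, η_0) g(η)`, with `g` a bulk observable of absolute value
at most `1`, gives `ℓ_N E[(η_0 - ρ(0)) g] = -E[(stirring + reservoir)(h g)]`. If `g` feels boundedly
many exchanges, the right side is bounded uniformly in `N`, so the left boundary averages at rate
`O(1/ℓ_N)` (`exists_left_averaging_const`). Taking `g = 1` bounds `ρ_N(0) - ρ(0)`; taking `g = η_k`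
bounds the correlation of sites `0` and `k`.

The reservoir acts on the last occupation variable like an exchange with a frozen site `N` of
density `β`. Hence the stationary density is discrete harmonic, so affine, in the bulk
(`IsStationary.density_eq`). Truncated two-point functions are subharmonic for two exclusion
particles, the source being minus the squared density gradient; they vanish at `N`, so the maximum
principle bounds them above by their values at the left boundary (`IsStationary.correlation_le`).

This bound is one-sided, which suffices for a second moment estimate with nonnegative weights
(`expect_abs_weighted_sum_le`). Splitting `G` into positive and negative parts then gives the limit.
Existence and uniqueness of the stationary states come from linear algebra and the maximum principle
for generators. -/

theorem expect_add (μ f g : S → ℝ) :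
    expect μ (fun s => f s + g s) = expect μ f + expect μ g := by
  simp [expect, mul_add, Finset.sum_add_distrib]

theorem expect_sub (μ f g : S → ℝ) :
    expect μ (fun s => f s - g s) = expect μ f - expect μ g := by
  simp [expect, mul_sub, Finset.sum_sub_distrib]

theorem expect_const_mul (μ f : S → ℝ) (c : ℝ) :
    expect μ (fun s => c * f s) = c * expect μ f := by
  simp only [expect, Finset.mul_sum]
  exact Finset.sum_congr rfl fun s _ => by ring

theorem expect_mul_const (μ f : S → ℝ) (c : ℝ) :
    expect μ (fun s => f s * c) = expect μ f * c := by
  simp only [expect, Finset.sum_mul]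
  exact Finset.sum_congr rfl fun s _ => by ring

theorem expect_sum {ι : Type*} (μ : S → ℝ) (T : Finset ι) (f : ι → S → ℝ) :
    expect μ (fun s => ∑ i ∈ T, f i s) = ∑ i ∈ T, expect μ (f i) := by
  simp only [expect, Finset.mul_sum]
  exact Finset.sum_comm

theorem expect_const {μ : S → ℝ} (hμ : μ ∈ stdSimplex ℝ S) (c : ℝ) :
    expect μ (fun _ => c) = c := by
  rw [expect, ← Finset.sum_mul, hμ.2, one_mul]

theorem expect_mono {μ f g : S → ℝ} (hμ : μ ∈ stdSimplex ℝ S) (h : ∀ s, f s ≤ g s) :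
    expect μ f ≤ expect μ g :=
  Finset.sum_le_sum fun s _ => mul_le_mul_of_nonneg_left (h s) (hμ.1 s)

theorem abs_expect_le {μ f : S → ℝ} {c : ℝ} (hμ : μ ∈ stdSimplex ℝ S)
    (h : ∀ s, |f s| ≤ c) : |expect μ f| ≤ c := by
  rw [abs_le]
  constructor
  · rw [← expect_const hμ (-c)]
    exact expect_mono hμ fun s => (abs_le.1 (h s)).1
  · rw [← expect_const hμ c]
    exact expect_mono hμ fun s => (abs_le.1 (h s)).2

/-- The variance of `|f|` is nonnegative. -/
theorem expect_abs_sq_le {μ : S → ℝ} (hμ : μ ∈ stdSimplex ℝ S) (f : S → ℝ) :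
    expect μ (fun s => |f s|) ≤ √(expect μ fun s => f s ^ 2) := by
  apply Real.le_sqrt_of_sq_le
  set m := expect μ (fun s => |f s|) with hm
  have h0 : 0 ≤ expect μ (fun s => (|f s| - m) ^ 2) := by
    rw [← expect_const hμ 0]
    exact expect_mono hμ fun s => sq_nonneg _
  have h1 : (fun s => (|f s| - m) ^ 2) = fun s => (f s ^ 2 - (2 * m) * |f s|) + m ^ 2 := by
    funext s
    rw [sub_sq, sq_abs]
    ring
  rw [h1, expect_add, expect_sub, expect_const_mul, expect_const hμ, ← hm] at h0
  nlinarith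

/-- The structural properties of the generator of a finite Markov chain with a single
recurrent class. -/
structure IsErgodicGenerator (L : (S → ℝ) → S → ℝ) : Prop where
  isLinearMap : IsLinearMap ℝ L
  nonpos_of_max : ∀ f s, (∀ t, f t ≤ f s) → L f s ≤ 0
  const_of_harmonic : ∀ f, L f = 0 → ∀ s t, f s = f t

variable {L : (S → ℝ) → S → ℝ}

/-- Every point maximizes a constant, so the maximum principle applies to both `c` and `-c`. -/
theorem IsErgodicGenerator.map_const (hL : IsErgodicGenerator L) (c : ℝ) :
    L (fun _ => c) = 0 := by
  have h1 : ∀ c : ℝ, ∀ s, L (fun _ => c) s ≤ 0 := fun c s =>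
    hL.nonpos_of_max _ s fun _ => le_rfl
  funext s
  apply le_antisymm (h1 c s)
  have h2 : L (fun _ => -c) s = - L (fun _ => c) s := congrFun (hL.isLinearMap.map_neg fun _ => c) s
  have h3 := h1 (-c) s
  change (0 : ℝ) ≤ _
  linarith

/-- The Poisson equation of an ergodic generator, for any nonzero functional annihilating its
range. -/
theorem IsErgodicGenerator.mem_range_of_annihilator [Nonempty S] (hL : IsErgodicGenerator L)
    {φ : (S → ℝ) →ₗ[ℝ] ℝ} (hφ : φ ≠ 0) (h : ∀ f, φ (L f) = 0) {g : S → ℝ} (hg : φ g = 0) :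
    ∃ f, L f = g := by
  let Λ : (S → ℝ) →ₗ[ℝ] (S → ℝ) := hL.isLinearMap.mk' L
  have hker : Module.finrank ℝ (LinearMap.ker Λ) ≤ 1 := by
    obtain ⟨s⟩ := ‹Nonempty S›
    refine finrank_le_one (⟨fun _ => 1, hL.map_const 1⟩ : LinearMap.ker Λ) fun w => ⟨w.1 s, ?_⟩
    ext t
    simpa using hL.const_of_harmonic w.1 w.2 s t
  have h1 := LinearMap.finrank_range_add_finrank_ker Λ
  have h2 := LinearMap.finrank_range_add_finrank_ker φ
  have h3 : Module.finrank ℝ (LinearMap.range φ) = 1 := by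
    rw [LinearMap.range_eq_top.2 (LinearMap.surjective hφ), finrank_top, Module.finrank_self]
  have hle : LinearMap.range Λ ≤ LinearMap.ker φ := by
    rintro _ ⟨f, rfl⟩
    exact h f
  -- The range of `L` has codimension at most one, because its kernel consists of constants, while
  -- `ker φ` has codimension exactly one.
  have heq := Submodule.eq_of_le_of_finrank_le hle (by omega)
  have : g ∈ LinearMap.range Λ := by
    rw [heq]
    exact hg
  exact this

theorem IsErgodicGenerator.not_all_pos [Nonempty S] (hL : IsErgodicGenerator L) (f : S → ℝ) :
    ¬ ∀ s, 0 < L f s := by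
  intro h
  obtain ⟨s, hs⟩ := Finite.exists_max f
  exact absurd (hL.nonpos_of_max f s hs) (not_le.2 (h s))

/-- The expectation under the weights `μ` as a linear functional. -/
def expectLinear (μ : S → ℝ) : (S → ℝ) →ₗ[ℝ] ℝ where
  toFun := expect μ
  map_add' := expect_add μ
  map_smul' c f := expect_const_mul μ f c

theorem expectLinear_apply (μ f : S → ℝ) : expectLinear μ f = expect μ f := rfl

theorem IsStationary.exists_poisson [Nonempty S] (hL : IsErgodicGenerator L) {μ : S → ℝ}
    (hμ : IsStationary L μ) (g : S → ℝ) : ∃ f, L f = fun s => g s - expect μ g := by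
  refine hL.mem_range_of_annihilator (φ := expectLinear μ) ?_ hμ.2 ?_
  · intro h
    have h1 := LinearMap.congr_fun h fun _ => (1 : ℝ)
    rw [expectLinear_apply, expect_const hμ.1] at h1
    simp at h1
  · rw [expectLinear_apply, expect_sub, expect_const hμ.1, sub_self]

/-- The Poisson equation for `μ` with right-hand side the indicator of `s`, integrated against `ν`,
gives `ν s = μ s`. -/
theorem IsErgodicGenerator.stationary_unique [Nonempty S] (hL : IsErgodicGenerator L)
    {μ ν : S → ℝ} (hμ : IsStationary L μ) (hν : IsStationary L ν) : μ = ν := by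
  classical
  funext s
  obtain ⟨f, hf⟩ := hμ.exists_poisson hL (Pi.single s 1)
  have h1 := hν.2 f
  rw [hf, expect_sub, expect_const hν.1] at h1
  simp only [expect, Pi.single_apply, mul_ite, mul_one, mul_zero, Finset.sum_ite_eq',
    Finset.mem_univ, if_true] at h1
  linarith

/-- The constant `1` is not in the range of `L`, so some nonzero functional annihilates the range.
Its weights cannot take both signs: otherwise a strictly positive `g` would be annihilated too,
hence be of the form `L f`, which is impossible at a maximum of `f`. Up to sign and normalization,
the weights are a stationary state. -/
theorem IsErgodicGenerator.exists_stationary [Nonempty S] (hL : IsErgodicGenerator L) :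
    ∃ μ, IsStationary L μ := by
  classical
  let Λ : (S → ℝ) →ₗ[ℝ] (S → ℝ) := hL.isLinearMap.mk' L
  have hlt : LinearMap.range Λ < ⊤ := by
    refine lt_top_iff_ne_top.2 fun h => ?_
    obtain ⟨f, hf⟩ := LinearMap.range_eq_top.1 h (fun _ => (1 : ℝ))
    exact hL.not_all_pos f fun s => by
      rw [show L f = fun _ => (1 : ℝ) from hf]
      exact one_pos
  obtain ⟨φ, hφ0, hφ⟩ := Submodule.exists_le_ker_of_lt_top _ hlt
  have hann : ∀ f, φ (L f) = 0 := fun f => hφ ⟨f, rfl⟩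
  set ν : S → ℝ := fun s => φ (Pi.single s 1) with hν
  have hφν : ∀ f, φ f = expect ν f := by
    intro f
    conv_lhs => rw [pi_eq_sum_univ' f]
    simp [expect, hν, mul_comm, map_sum]
  have key : ∀ s t, 0 < ν s → ν t < 0 → False := by
    intro s t hs ht
    have hpos : ∃ g : S → ℝ, (∀ x, 0 < g x) ∧ φ g = 0 := by
      have hone : ∀ (x : S) (c : ℝ), φ (fun y => 1 + c * (Pi.single x (1 : ℝ) : S → ℝ) y) =
          φ (fun _ => 1) + c * ν x := by
        intro x c
        have : (fun y => 1 + c * (Pi.single x (1 : ℝ) : S → ℝ) y) =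
          (fun _ => (1 : ℝ)) + c • (Pi.single x (1 : ℝ) : S → ℝ) := rfl
        rw [this, map_add, map_smul, smul_eq_mul]
      have hsingle : ∀ x y : S, (0 : ℝ) ≤ (Pi.single x (1 : ℝ) : S → ℝ) y := by
        intro x y
        rw [Pi.single_apply]
        split_ifs <;> norm_num
      -- The positive function is `1` plus a nonnegative multiple of a point mass, put where the
      -- weight has the sign opposite to `φ 1`.
      rcases le_total 0 (φ fun _ => 1) with hm | hm
      · refine ⟨_, fun y => ?_, (hone t (φ (fun _ => 1) / (-ν t))).trans ?_⟩
        · have := mul_nonneg (div_nonneg hm (neg_nonneg.2 ht.le)) (hsingle t y)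
          linarith
        · rw [div_neg, neg_mul, div_mul_cancel₀ _ ht.ne]
          ring
      · refine ⟨_, fun y => ?_, (hone s ((-φ (fun _ => 1)) / ν s)).trans ?_⟩
        · have := mul_nonneg (div_nonneg (neg_nonneg.2 hm) hs.le) (hsingle s y)
          linarith
        · field_simp
          ring
    obtain ⟨g, hg, hg0⟩ := hpos
    obtain ⟨f, hf⟩ := hL.mem_range_of_annihilator hφ0 hann hg0
    exact hL.not_all_pos f fun x => hf ▸ hg x
  have hνne : ∃ s, ν s ≠ 0 := by
    by_contra! h
    apply hφ0
    ext f
    simpa [hν] using h f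
  have main : ∀ ν' : S → ℝ, (∀ s, 0 ≤ ν' s) → (∃ s, ν' s ≠ 0) → (∀ f, expect ν' (L f) = 0) →
      ∃ μ, IsStationary L μ := by
    intro ν' h0 ⟨s, hs⟩ h
    have hsum : 0 < ∑ s, ν' s :=
      Finset.sum_pos' (fun s _ => h0 s) ⟨s, Finset.mem_univ s, lt_of_le_of_ne (h0 s) hs.symm⟩
    refine ⟨fun s => (∑ t, ν' t)⁻¹ * ν' s, ⟨fun s => mul_nonneg (inv_nonneg.2 hsum.le) (h0 s), ?_⟩,
      fun f => ?_⟩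
    · rw [← Finset.mul_sum, inv_mul_cancel₀ hsum.ne']
    · have := h f
      simp only [expect] at this ⊢
      simp only [mul_assoc]
      rw [← Finset.mul_sum, this, mul_zero]
  by_cases hs : ∃ s, 0 < ν s
  · obtain ⟨s, hs⟩ := hs
    refine main ν (fun t => not_lt.1 fun ht => key s t hs ht) hνne fun f => ?_
    rw [← hφν, hann]
  · push Not at hs
    refine main (fun s => -ν s) (fun t => neg_nonneg.2 (hs t)) ?_ fun f => ?_
    · simpa using hνne
    · have := hann f
      rw [hφν] at this
      simpa [expect] using this

theorem IsErgodicGenerator.existsUnique_stationary [Nonempty S] (hL : IsErgodicGenerator L) :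
    ∃! μ, IsStationary L μ := by
  obtain ⟨μ, hμ⟩ := hL.exists_stationary
  exact ⟨μ, hμ, fun ν hν => hL.stationary_unique hν hμ⟩

/-- At a maximum of a harmonic function every term of the generator is nonpositive, so each vanishes
and the maximum spreads along jumps of positive rate. The unconstrained diagonal rates multiply
zero. -/
theorem chainGen_isErgodicGenerator {R : S → S → ℝ} (hR : ∀ s t, s ≠ t → 0 ≤ R s t)
    (hirr : IsIrreducibleChain R) : IsErgodicGenerator (chainGen R) := by
  have hterm : ∀ (f : S → ℝ) s, (∀ t, f t ≤ f s) → ∀ t, R s t * (f t - f s) ≤ 0 := by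
    intro f s hs t
    rcases eq_or_ne s t with rfl | hst
    · simp
    · exact mul_nonpos_of_nonneg_of_nonpos (hR s t hst) (sub_nonpos.2 (hs t))
  refine ⟨⟨fun f g => ?_, fun c f => ?_⟩, fun f s hs => ?_, fun f hf => ?_⟩
  · funext s
    simp only [chainGen, Pi.add_apply, ← Finset.sum_add_distrib]
    exact Finset.sum_congr rfl fun t _ => by ring
  · funext s
    simp only [chainGen, Pi.smul_apply, smul_eq_mul, Finset.mul_sum]
    exact Finset.sum_congr rfl fun t _ => by ring
  · exact Finset.sum_nonpos fun t _ => hterm f s hs t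
  · rcases isEmpty_or_nonempty S with hS | hS
    · exact fun s => hS.elim s
    obtain ⟨m, hm⟩ := Finite.exists_max f
    have hall : ∀ t, f t = f m := by
      intro t
      induction hirr m t with
      | refl => rfl
      | @tail b c _ hbc ih =>
        have hb : ∀ x, f x ≤ f b := fun x => ih ▸ hm x
        have h0 := (Finset.sum_eq_zero_iff_of_nonpos fun x _ => hterm f b hb x).1
          (congrFun hf b) c (Finset.mem_univ c)
        rcases mul_eq_zero.1 h0 with h | h
        · exact absurd h hbc.ne'
        · linarith
    exact fun s t => (hall s).trans (hall t).symm

end FiniteGenerator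

/-! ### The Dirichlet problem on the unit interval -/

theorem solvesDirichlet_affine (a b : ℝ) :
    SolvesDirichlet a b fun x => a + (b - a) * x where
  continuousOn := by fun_prop
  contDiffOn := by fun_prop
  laplace x _ := by
    have h : deriv (fun x : ℝ => a + (b - a) * x) = fun _ => b - a := by
      funext y
      simp
    rw [iteratedDeriv_succ, iteratedDeriv_one, h, deriv_const]
  left := by simp
  right := by simp

/-- The equation makes the derivative constant on the open interval; continuity extends the affine
form to the endpoints, whose values fix the coefficients. -/
theorem SolvesDirichlet.eqOn_affine {a b : ℝ} {v : ℝ → ℝ} (hv : SolvesDirichlet a b v) :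
    Set.EqOn v (fun x => a + (b - a) * x) (Set.Icc 0 1) := by
  have hdiff : DifferentiableOn ℝ v (Set.Ioo 0 1) :=
    hv.contDiffOn.differentiableOn (by norm_num)
  have hdiff' : DifferentiableOn ℝ (deriv v) (Set.Ioo 0 1) := by
    have := (contDiffOn_succ_iff_deriv_of_isOpen (n := 1) isOpen_Ioo).1
      (by simpa [one_add_one_eq_two] using hv.contDiffOn)
    exact this.2.2.differentiableOn (by norm_num)
  obtain ⟨c, hc⟩ : ∃ c, ∀ x ∈ Set.Ioo (0 : ℝ) 1, deriv v x = c := by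
    refine isOpen_Ioo.exists_is_const_of_deriv_eq_zero isPreconnected_Ioo hdiff' fun x hx => ?_
    have := hv.laplace x hx
    rwa [iteratedDeriv_succ, iteratedDeriv_one] at this
  obtain ⟨d, hd⟩ : ∃ d, ∀ x ∈ Set.Ioo (0 : ℝ) 1, v x - c * x = d := by
    refine isOpen_Ioo.exists_is_const_of_deriv_eq_zero isPreconnected_Ioo
      (hdiff.sub (by fun_prop)) fun x hx => ?_
    have h1 : DifferentiableAt ℝ v x := hdiff.differentiableAt (isOpen_Ioo.mem_nhds hx)
    have h2 : HasDerivAt (fun y => v y - c * y) (deriv v x - c * 1) x :=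
      h1.hasDerivAt.sub ((hasDerivAt_id x).const_mul c)
    simpa [hc x hx] using h2.deriv
  have hcl : Set.EqOn v (fun x => c * x + d) (Set.Icc 0 1) := by
    have : Set.EqOn v (fun x => c * x + d) (Set.Ioo 0 1) := fun x hx => by
      have := hd x hx
      simp only
      linarith
    refine this.of_subset_closure hv.continuousOn (by fun_prop) Set.Ioo_subset_Icc_self ?_
    rw [closure_Ioo (by norm_num)]
  have h0 := hcl (show (0 : ℝ) ∈ Set.Icc 0 1 by simp)
  have h1 := hcl (show (1 : ℝ) ∈ Set.Icc 0 1 by simp)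
  simp only [hv.left, hv.right] at h0 h1
  intro x hx
  rw [hcl hx]
  simp only
  rw [h1, h0]
  ring

/-! ### Configurations -/

section Configurations

variable {Λ : Finset ℤ}

theorem stateAt_of_mem (η : Config Λ) {k : ℤ} (hk : k ∈ Λ) : stateAt η k = η ⟨k, hk⟩ :=
  dif_pos hk

theorem stateAt_of_notMem (η : Config Λ) {k : ℤ} (hk : k ∉ Λ) : stateAt η k = false :=
  dif_neg hk

theorem config_ext {η ζ : Config Λ} (h : ∀ k ∈ Λ, stateAt η k = stateAt ζ k) : η = ζ := by
  funext ⟨k, hk⟩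
  simpa [stateAt_of_mem _ hk] using h k hk

theorem occ_congr {Λ' : Finset ℤ} {η : Config Λ} {ζ : Config Λ'} {j k : ℤ}
    (h : stateAt η j = stateAt ζ k) : occ η j = occ ζ k := by
  rw [occ, occ, h]

theorem occ_eq_zero_or_one (η : Config Λ) (k : ℤ) : occ η k = 0 ∨ occ η k = 1 := by
  rw [occ]
  split_ifs <;> simp

theorem occ_nonneg (η : Config Λ) (k : ℤ) : 0 ≤ occ η k := by
  rcases occ_eq_zero_or_one η k with h | h <;> simp [h]

theorem occ_le_one (η : Config Λ) (k : ℤ) : occ η k ≤ 1 := by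
  rcases occ_eq_zero_or_one η k with h | h <;> simp [h]

theorem occ_mul_self (η : Config Λ) (k : ℤ) : occ η k * occ η k = occ η k := by
  rcases occ_eq_zero_or_one η k with h | h <;> simp [h]

theorem stateAt_exchange (η : Config Λ) {a b : ℤ} (ha : a ∈ Λ) (hb : b ∈ Λ) (k : ℤ) :
    stateAt (exchange a b η) k = stateAt η (Equiv.swap a b k) := by
  by_cases hk : k ∈ Λ
  · rw [stateAt_of_mem _ hk, exchange]
  · rw [Equiv.swap_apply_of_ne_of_ne (by rintro rfl; exact hk ha) (by rintro rfl; exact hk hb),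
      stateAt_of_notMem _ hk, stateAt_of_notMem _ hk]

theorem occ_exchange (η : Config Λ) {a b : ℤ} (ha : a ∈ Λ) (hb : b ∈ Λ) (k : ℤ) :
    occ (exchange a b η) k = occ η (Equiv.swap a b k) :=
  occ_congr (stateAt_exchange η ha hb k)

theorem stateAt_flipAt_of_ne (η : Config Λ) {a k : ℤ} (h : k ≠ a) :
    stateAt (flipAt a η) k = stateAt η k := by
  by_cases hk : k ∈ Λ
  · rw [stateAt_of_mem _ hk, stateAt_of_mem _ hk, flipAt, if_neg h]
  · rw [stateAt_of_notMem _ hk, stateAt_of_notMem _ hk]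

theorem stateAt_flipAt_self (η : Config Λ) {a : ℤ} (ha : a ∈ Λ) :
    stateAt (flipAt a η) a = !stateAt η a := by
  rw [stateAt_of_mem _ ha, stateAt_of_mem _ ha, flipAt, if_pos rfl]

theorem occ_flipAt_of_ne (η : Config Λ) {a k : ℤ} (h : k ≠ a) :
    occ (flipAt a η) k = occ η k :=
  occ_congr (stateAt_flipAt_of_ne η h)

theorem occ_flipAt_self (η : Config Λ) {a : ℤ} (ha : a ∈ Λ) :
    occ (flipAt a η) a = 1 - occ η a := by
  rw [occ, occ, stateAt_flipAt_self η ha]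
  cases stateAt η a <;> simp

/-- Conjugating by exchanges transports the only available flip, at the reservoir, to any bulk site.
-/
theorem flipAt_eq_exchange (η : Config Λ) {a b : ℤ} (ha : a ∈ Λ) (hb : b ∈ Λ) :
    flipAt a η = exchange a b (flipAt b (exchange a b η)) := by
  refine config_ext fun k hk => ?_
  rw [stateAt_exchange _ ha hb]
  by_cases hka : k = a
  · subst hka
    rw [stateAt_flipAt_self _ hk, Equiv.swap_apply_left, stateAt_flipAt_self _ hb,
      stateAt_exchange _ ha hb, Equiv.swap_apply_right]
  · have hne : Equiv.swap a b k ≠ b := by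
      intro h
      apply hka
      exact (Equiv.swap a b).injective (h.trans (Equiv.swap_apply_left a b).symm)
    rw [stateAt_flipAt_of_ne _ hka, stateAt_flipAt_of_ne _ hne, stateAt_exchange _ ha hb,
      ← Equiv.Perm.mul_apply, Equiv.swap_mul_self, Equiv.Perm.one_apply]

end Configurations

/-! ### Moves of the boundary driven chain and its ergodicity -/

section Sites

variable {p N : ℕ}

theorem mem_sites {k : ℤ} (h0 : 0 ≤ k) (h1 : k ≤ (N : ℤ) - 1) : k ∈ sites p N :=
  Finset.mem_Icc.2 ⟨by omega, h1⟩

theorem stateAt_leftPart (η : Config (sites p N)) {k : ℤ} (hk : k ≤ 0) :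
    stateAt (leftPart η) k = stateAt η k := by
  by_cases h : k ∈ leftSites p
  · rw [stateAt_of_mem _ h, leftPart]
  · rw [stateAt_of_notMem _ h, stateAt_of_notMem]
    simp only [Finset.mem_Icc] at h ⊢
    omega

theorem stateAt_replaceLeft_of_nonpos (hN : 1 ≤ N) (ξ : Config (leftSites p))
    (η : Config (sites p N)) {k : ℤ} (hk : k ≤ 0) :
    stateAt (replaceLeft ξ η) k = stateAt ξ k := by
  by_cases h : k ∈ sites p N
  · rw [stateAt_of_mem _ h, replaceLeft, if_pos hk]
  · rw [stateAt_of_notMem _ h, stateAt_of_notMem]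
    simp only [Finset.mem_Icc] at h ⊢
    omega

theorem stateAt_replaceLeft_of_pos (ξ : Config (leftSites p))
    (η : Config (sites p N)) {k : ℤ} (hk : 0 < k) :
    stateAt (replaceLeft ξ η) k = stateAt η k := by
  by_cases h : k ∈ sites p N
  · rw [stateAt_of_mem _ h, stateAt_of_mem _ h, replaceLeft, if_neg (not_le.2 hk)]
  · rw [stateAt_of_notMem _ h, stateAt_of_notMem _ h]

theorem leftPart_congr {η ζ : Config (sites p N)}
    (h : ∀ k ≤ (0 : ℤ), stateAt η k = stateAt ζ k) : leftPart η = leftPart ζ := by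
  refine config_ext fun k hk => ?_
  have := (Finset.mem_Icc.1 hk).2
  rw [stateAt_leftPart η this, stateAt_leftPart ζ this, h k this]

theorem leftPart_replaceLeft (hN : 1 ≤ N) (ξ : Config (leftSites p)) (η : Config (sites p N)) :
    leftPart (replaceLeft ξ η) = ξ := by
  refine config_ext fun k hk => ?_
  have := (Finset.mem_Icc.1 hk).2
  rw [stateAt_leftPart _ this, stateAt_replaceLeft_of_nonpos hN _ _ this]

theorem replaceLeft_replaceLeft (hN : 1 ≤ N) (ξ ξ' : Config (leftSites p))
    (η : Config (sites p N)) : replaceLeft ξ (replaceLeft ξ' η) = replaceLeft ξ η := by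
  refine config_ext fun k _ => ?_
  rcases le_or_gt k 0 with h | h
  · rw [stateAt_replaceLeft_of_nonpos hN _ _ h, stateAt_replaceLeft_of_nonpos hN _ _ h]
  · rw [stateAt_replaceLeft_of_pos _ _ h, stateAt_replaceLeft_of_pos _ _ h,
      stateAt_replaceLeft_of_pos _ _ h]

theorem replaceLeft_leftPart_of_eq (hN : 1 ≤ N) {η ζ : Config (sites p N)}
    (h : ∀ k, 0 < k → stateAt η k = stateAt ζ k) : replaceLeft (leftPart η) ζ = η := by
  refine config_ext fun k _ => ?_
  rcases le_or_gt k 0 with hk | hk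
  · rw [stateAt_replaceLeft_of_nonpos hN _ _ hk, stateAt_leftPart _ hk]
  · rw [stateAt_replaceLeft_of_pos _ _ hk, h k hk]

theorem leftPart_exchange {a b : ℤ} (ha : 0 < a) (hb : 0 < b) (ha' : a ≤ (N : ℤ) - 1)
    (hb' : b ≤ (N : ℤ) - 1) (η : Config (sites p N)) :
    leftPart (exchange a b η) = leftPart η := by
  refine leftPart_congr fun k hk => ?_
  rw [stateAt_exchange _ (mem_sites ha.le ha') (mem_sites hb.le hb'),
    Equiv.swap_apply_of_ne_of_ne (by omega) (by omega)]

/-- A set of configurations which is stable under the moves of the boundary driven exclusion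
process contains all configurations as soon as it is nonempty. -/
theorem mem_of_closed (hN : 1 ≤ N) {A : Set (Config (sites p N))}
    (hleft : ∀ η ∈ A, ∀ ξ, replaceLeft ξ η ∈ A)
    (hexch : ∀ η ∈ A, ∀ k : ℤ, 0 ≤ k → k ≤ (N : ℤ) - 2 → exchange k (k + 1) η ∈ A)
    (hflip : ∀ η ∈ A, flipAt ((N : ℤ) - 1) η ∈ A) {η : Config (sites p N)} (hη : η ∈ A)
    (ζ : Config (sites p N)) : ζ ∈ A := by
  -- Induction on the distance `m` to the reservoir site `N - 1`.
  have hflips : ∀ m : ℕ, ∀ k : ℤ, k = (N : ℤ) - 1 - m → 0 ≤ k → ∀ η ∈ A, flipAt k η ∈ A := by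
    intro m
    induction m with
    | zero =>
      intro k hk _ η hη
      rw [show k = (N : ℤ) - 1 by simpa using hk]
      exact hflip η hη
    | succ m ih =>
      intro k hk h0 η hη
      push_cast at hk
      rw [flipAt_eq_exchange η (b := k + 1) (mem_sites h0 (by omega))
        (mem_sites (by omega) (by omega))]
      exact hexch _ (ih (k + 1) (by omega) (by omega) _ (hexch η hη k h0 (by omega))) k h0
        (by omega)
  -- The bulk of `ζ` is reproduced site by site from the left, each flip leaving the other sites
  -- intact. Beyond `N - 1` both states are the default `false`, so `m` may overshoot.
  have hpart : ∀ m : ℕ, ∃ η ∈ A, ∀ k : ℤ, 0 < k → k ≤ m → stateAt η k = stateAt ζ k := by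
    intro m
    induction m with
    | zero => exact ⟨η, hη, fun k h0 h1 => by omega⟩
    | succ m ih =>
      obtain ⟨θ, hθ, h⟩ := ih
      by_cases heq : stateAt θ ((m : ℤ) + 1) = stateAt ζ ((m : ℤ) + 1)
      · refine ⟨θ, hθ, fun k h0 h1 => ?_⟩
        rcases eq_or_ne k ((m : ℤ) + 1) with rfl | hk
        · exact heq
        · exact h k h0 (by push_cast at h1; omega)
      · have hmem : (m : ℤ) + 1 ∈ sites p N := by
          by_contra hmem
          rw [stateAt_of_notMem _ hmem, stateAt_of_notMem _ hmem] at heq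
          exact heq rfl
        have hle := (Finset.mem_Icc.1 hmem).2
        refine ⟨flipAt ((m : ℤ) + 1) θ,
          hflips (N - 2 - m) _ (by omega) (by omega) θ hθ, fun k h0 h1 => ?_⟩
        rcases eq_or_ne k ((m : ℤ) + 1) with rfl | hk
        · rw [stateAt_flipAt_self _ hmem]
          cases h2 : stateAt θ ((m : ℤ) + 1) <;> cases h3 : stateAt ζ ((m : ℤ) + 1) <;>
            simp_all
        · rw [stateAt_flipAt_of_ne _ hk]
          exact h k h0 (by push_cast at h1; omega)
  obtain ⟨θ, hθ, h⟩ := hpart N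
  have := hleft θ hθ (leftPart ζ)
  rwa [replaceLeft_leftPart_of_eq hN] at this
  intro k hk
  rcases le_or_gt k N with h1 | h1
  · exact (h k hk h1).symm
  · have : k ∉ sites p N := by
      simp only [Finset.mem_Icc]
      omega
    rw [stateAt_of_notMem _ this, stateAt_of_notMem _ this]

/-- The stirring dynamics on `{0, …, N - 1}`. -/
noncomputable def stirGen (f : Config (sites p N) → ℝ) (η : Config (sites p N)) : ℝ :=
  ∑ k ∈ Finset.Icc (0 : ℤ) ((N : ℤ) - 2), (f (exchange k (k + 1) η) - f η)

theorem junctionGen_add_bulkGen (hN : 2 ≤ N) (f : Config (sites p N) → ℝ)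
    (η : Config (sites p N)) : junctionGen f η + bulkGen f η = stirGen f η := by
  have h : Finset.Icc (0 : ℤ) ((N : ℤ) - 2) = insert 0 (Finset.Icc 1 ((N : ℤ) - 2)) := by
    ext k
    simp only [Finset.mem_insert, Finset.mem_Icc]
    omega
  rw [stirGen, h, Finset.sum_insert (by simp), junctionGen, bulkGen, zero_add]

theorem fullGen_eq (hN : 2 ≤ N) (R : Config (leftSites p) → Config (leftSites p) → ℝ)
    (l β : ℝ) (f : Config (sites p N) → ℝ) (η : Config (sites p N)) :
    fullGen N R l β f η = l * leftGen N R f η + stirGen f η + rightGen β f η := by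
  rw [fullGen, ← junctionGen_add_bulkGen hN, ← add_assoc]

theorem rightRate_pos {β : ℝ} (hβ : β ∈ Set.Ioo (0 : ℝ) 1) (η : Config (sites p N)) (k : ℤ) :
    0 < β * (1 - occ η k) + (1 - β) * occ η k := by
  obtain ⟨h0, h1⟩ := hβ
  rcases occ_eq_zero_or_one η k with h | h <;> rw [h] <;> linarith

theorem rightRate_le_one {β : ℝ} (hβ : β ∈ Set.Ioo (0 : ℝ) 1) (η : Config (sites p N)) (k : ℤ) :
    β * (1 - occ η k) + (1 - β) * occ η k ≤ 1 := by
  obtain ⟨h0, h1⟩ := hβ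
  rcases occ_eq_zero_or_one η k with h | h <;> rw [h] <;> linarith

/-- At a maximum of a harmonic function the three parts of the generator are nonpositive with sum
zero, so each vanishes. The set of maximizers is then closed under all the moves, and
`mem_of_closed` applies. -/
theorem fullGen_isErgodicGenerator (hN : 2 ≤ N)
    {R : Config (leftSites p) → Config (leftSites p) → ℝ}
    (hR : ∀ ξ ξ', ξ ≠ ξ' → 0 ≤ R ξ ξ') (hirr : IsIrreducibleChain R)
    {l β : ℝ} (hl : 0 < l) (hβ : β ∈ Set.Ioo (0 : ℝ) 1) :
    IsErgodicGenerator (fullGen N R l β) := by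
  have hN1 : 1 ≤ N := by omega
  have hleft : ∀ (f : Config (sites p N) → ℝ) η, (∀ ζ, f ζ ≤ f η) → ∀ ξ,
      R (leftPart η) ξ * (f (replaceLeft ξ η) - f η) ≤ 0 := by
    intro f η hη ξ
    rcases eq_or_ne (leftPart η) ξ with rfl | hξ
    · rw [replaceLeft_leftPart_of_eq hN1 fun _ _ => rfl]
      simp
    · exact mul_nonpos_of_nonneg_of_nonpos (hR _ _ hξ) (sub_nonpos.2 (hη _))
  have hL0 : ∀ (f : Config (sites p N) → ℝ) η, (∀ ζ, f ζ ≤ f η) → leftGen N R f η ≤ 0 :=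
    fun f η hη => Finset.sum_nonpos fun ξ _ => hleft f η hη ξ
  have hS0 : ∀ (f : Config (sites p N) → ℝ) η, (∀ ζ, f ζ ≤ f η) → stirGen f η ≤ 0 :=
    fun f η hη => Finset.sum_nonpos fun k _ => sub_nonpos.2 (hη _)
  have hR0 : ∀ (f : Config (sites p N) → ℝ) η, (∀ ζ, f ζ ≤ f η) → rightGen β f η ≤ 0 :=
    fun f η hη => mul_nonpos_of_nonneg_of_nonpos (rightRate_pos hβ η _).le (sub_nonpos.2 (hη _))
  refine ⟨⟨fun f g => ?_, fun c f => ?_⟩, fun f η hη => ?_, fun f hf => ?_⟩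
  · funext η
    simp only [fullGen_eq hN, leftGen, stirGen, rightGen, Pi.add_apply]
    have h1 : ∀ a b c d : ℝ, a + b - (c + d) = (a - c) + (b - d) := fun a b c d => by ring
    simp only [h1, mul_add, Finset.sum_add_distrib]
    ring
  · funext η
    simp only [fullGen_eq hN, leftGen, stirGen, rightGen, Pi.smul_apply, smul_eq_mul]
    simp only [← mul_sub, mul_left_comm _ c, ← Finset.mul_sum]
    ring
  · rw [fullGen_eq hN]
    have := mul_nonpos_of_nonneg_of_nonpos hl.le (hL0 f η hη)
    linarith [hS0 f η hη, hR0 f η hη]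
  · obtain ⟨m, hm⟩ := Finite.exists_max f
    have hmax : ∀ η, f η = f m → ∀ ζ, f ζ ≤ f η := fun η h ζ => h ▸ hm ζ
    have hzero : ∀ η, f η = f m →
        leftGen N R f η = 0 ∧ stirGen f η = 0 ∧ rightGen β f η = 0 := by
      intro η hη
      have h0 : fullGen N R l β f η = 0 := congrFun hf η
      rw [fullGen_eq hN] at h0
      have h1 := hL0 f η (hmax η hη)
      have h2 := hS0 f η (hmax η hη)
      have h3 := hR0 f η (hmax η hη)
      have h4 := mul_nonpos_of_nonneg_of_nonpos hl.le h1
      refine ⟨?_, by linarith, by linarith⟩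
      have h5 : l * leftGen N R f η = 0 := by linarith
      exact (mul_eq_zero.1 h5).resolve_left hl.ne'
    have hall : ∀ ζ, ζ ∈ {η | f η = f m} := by
      refine fun ζ => mem_of_closed (A := {η | f η = f m}) hN1 (fun η hη ξ => ?_) (fun η hη k h0 h1 => ?_)
        (fun η hη => ?_) (η := m) rfl ζ
      -- The maximum is carried along a path of the left chain while the bulk stays fixed.
      · induction hirr (leftPart η) ξ with
        | refl => rwa [replaceLeft_leftPart_of_eq hN1 fun _ _ => rfl]
        | @tail b c _ hbc ih =>
          have h := (Finset.sum_eq_zero_iff_of_nonpos fun ξ _ => hleft f _ (hmax _ ih) ξ).1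
            (hzero _ ih).1 c (Finset.mem_univ c)
          rw [leftPart_replaceLeft hN1, replaceLeft_replaceLeft hN1] at h
          have h' := (mul_eq_zero.1 h).resolve_left hbc.ne'
          rw [Set.mem_ofPred_eq] at ih ⊢
          linarith
      · have h := (Finset.sum_eq_zero_iff_of_nonpos fun k _ => sub_nonpos.2 (hmax η hη _)).1
          (hzero η hη).2.1 k (Finset.mem_Icc.2 ⟨h0, h1⟩)
        rw [Set.mem_ofPred_eq] at hη ⊢
        linarith
      · have h := (mul_eq_zero.1 (hzero η hη).2.2).resolve_left (rightRate_pos hβ η _).ne'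
        rw [Set.mem_ofPred_eq] at hη ⊢
        linarith
    exact fun s t => (hall s).trans (hall t).symm

end Sites

/-! ### Harmonic functions on pairs of sites -/

theorem swap_succ_mem_Icc {a j N : ℤ} (h0 : 0 ≤ a) (h1 : a + 1 ≤ N) (hj0 : 0 ≤ j) (hj : j ≤ N) :
    0 ≤ Equiv.swap a (a + 1) j ∧ Equiv.swap a (a + 1) j ≤ N := by
  rw [Equiv.swap_apply_def]
  split_ifs <;> omega

/-- A one-particle observable only feels the two exchanges next to its site. -/
theorem sum_swap_sub (f : ℤ → ℝ) {j N : ℤ} (h1 : 1 ≤ j) (hj : j ≤ N - 1) :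
    ∑ a ∈ Finset.Icc 0 (N - 1), (f (Equiv.swap a (a + 1) j) - f j) =
      (f (j - 1) - f j) + (f (j + 1) - f j) := by
  have hsub : ({j - 1, j} : Finset ℤ) ⊆ Finset.Icc 0 (N - 1) := by
    intro a ha
    simp only [Finset.mem_insert, Finset.mem_singleton] at ha
    rw [Finset.mem_Icc]
    omega
  rw [← Finset.sum_subset hsub, Finset.sum_pair (by omega)]
  · have h2 : Equiv.swap (j - 1) (j - 1 + 1) j = j - 1 := by
      rw [sub_add_cancel, Equiv.swap_apply_right]
    rw [h2, Equiv.swap_apply_left]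
  · intro a _ ha
    simp only [Finset.mem_insert, Finset.mem_singleton, not_or] at ha
    rw [Equiv.swap_apply_of_ne_of_ne (by omega) (by omega), sub_self]

theorem eq_affine_of_discrete_harmonic {f : ℤ → ℝ} {N : ℕ} (hN : 1 ≤ N)
    (h : ∀ j : ℤ, 1 ≤ j → j ≤ (N : ℤ) - 1 → (f (j - 1) - f j) + (f (j + 1) - f j) = 0)
    {k : ℕ} (hk : k ≤ N) : f k = f 0 + (k / N) * (f N - f 0) := by
  -- Two consecutive values are carried along, since the recursion is of second order.
  have hlin : ∀ k : ℕ, k + 1 ≤ N →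
      f k = f 0 + k * (f 1 - f 0) ∧ f ((k : ℤ) + 1) = f 0 + (k + 1) * (f 1 - f 0) := by
    intro k
    induction k with
    | zero => intro _; constructor <;> simp
    | succ k ih =>
      intro hk
      obtain ⟨h1, h2⟩ := ih (by omega)
      have h3 := h ((k : ℤ) + 1) (by omega) (by omega)
      rw [add_sub_cancel_right] at h3
      push_cast
      exact ⟨h2, by linarith⟩
  have hlin' : ∀ k : ℕ, k ≤ N → f k = f 0 + k * (f 1 - f 0) := by
    intro k hk
    rcases k with _ | k
    · simp
    · have := (hlin k hk).2
      push_cast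
      exact this
  rw [hlin' k hk, hlin' N le_rfl]
  have : (N : ℝ) ≠ 0 := by positivity
  field_simp
  ring

/-- The maximum principle for two exclusion particles on `{1, …, N - 1}` which are absorbed at
the sites `0` and `N`. -/
theorem pair_maximum_principle {φ : ℤ → ℤ → ℝ} {c : ℝ} {n : ℤ}
    (hsymm : ∀ j k, φ j k = φ k j)
    (hsub : ∀ j k : ℤ, 1 ≤ j → j < k → k ≤ n - 1 →
      0 ≤ ∑ a ∈ Finset.Icc 0 (n - 1),
        (φ (Equiv.swap a (a + 1) j) (Equiv.swap a (a + 1) k) - φ j k))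
    (hleft : ∀ k, 1 ≤ k → k ≤ n → φ 0 k ≤ c)
    (hright : ∀ j, 0 ≤ j → j < n → φ j n ≤ c)
    {j k : ℤ} (hj : 0 ≤ j) (hjk : j < k) (hk : k ≤ n) : φ j k ≤ c := by
  set T : Finset (ℤ × ℤ) := (Finset.Icc 0 n ×ˢ Finset.Icc 0 n).filter fun x => x.1 < x.2 with hT
  have memT : ∀ x : ℤ × ℤ, x ∈ T ↔ 0 ≤ x.1 ∧ x.1 < x.2 ∧ x.2 ≤ n := by
    intro x
    simp only [hT, Finset.mem_filter, Finset.mem_product, Finset.mem_Icc]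
    omega
  have hmem : (j, k) ∈ T := (memT _).2 ⟨hj, hjk, hk⟩
  obtain ⟨x, hx, hmax⟩ := T.exists_max_image (fun x => φ x.1 x.2) ⟨_, hmem⟩
  -- Among the maximizing pairs, one with leftmost first particle is chosen. If it were interior,
  -- subharmonicity would force equality in every exchange, and moving the first particle one step
  -- left would give a maximizer further to the left.
  obtain ⟨y, hy, hmin⟩ := (T.filter fun y => φ y.1 y.2 = φ x.1 x.2).exists_min_image
    (fun y => y.1) ⟨x, Finset.mem_filter.2 ⟨hx, rfl⟩⟩
  obtain ⟨hyT, hyx⟩ := Finset.mem_filter.1 hy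
  obtain ⟨h0, hlt, hn⟩ := (memT y).1 hyT
  have hbound : ∀ i l : ℤ, 0 ≤ i → 0 ≤ l → i ≤ n → l ≤ n → i ≠ l → φ i l ≤ φ y.1 y.2 := by
    intro i l hi hl hin hln hne
    rw [hyx]
    rcases lt_or_gt_of_ne hne with h | h
    · exact hmax (i, l) ((memT _).2 ⟨hi, h, hln⟩)
    · rw [hsymm]
      exact hmax (l, i) ((memT _).2 ⟨hl, h, hin⟩)
  refine (hbound j k hj (by omega) (by omega) hk hjk.ne).trans ?_
  by_cases hy0 : y.1 = 0
  · rw [hy0]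
    exact hleft _ (by omega) hn
  by_cases hyn : y.2 = n
  · rw [hyn]
    exact hright _ h0 (by omega)
  exfalso
  have hterm : ∀ a ∈ Finset.Icc 0 (n - 1),
      φ (Equiv.swap a (a + 1) y.1) (Equiv.swap a (a + 1) y.2) - φ y.1 y.2 ≤ 0 := by
    intro a ha
    rw [Finset.mem_Icc] at ha
    have h1 := swap_succ_mem_Icc (N := n) ha.1 (by omega) h0 (by omega)
    have h2 := swap_succ_mem_Icc (N := n) (j := y.2) ha.1 (by omega) (by omega) hn
    exact sub_nonpos.2 (hbound _ _ h1.1 h2.1 h1.2 h2.2 ((Equiv.injective _).ne hlt.ne))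
  have hzero := (Finset.sum_eq_zero_iff_of_nonpos hterm).1
    (le_antisymm (Finset.sum_nonpos hterm) (hsub y.1 y.2 (by omega) hlt (by omega)))
    -- This exchange moves only the first particle, since `y.1 < y.2`.
    (y.1 - 1) (Finset.mem_Icc.2 ⟨by omega, by omega⟩)
  rw [sub_add_cancel, Equiv.swap_apply_right, Equiv.swap_apply_of_ne_of_ne (by omega) (by omega),
    sub_eq_zero] at hzero
  have := hmin (y.1 - 1, y.2)
    (Finset.mem_filter.2 ⟨(memT _).2 ⟨by simp only; omega, by simp only; omega, hn⟩, hzero.trans hyx⟩)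
  simp only at this
  omega

/-! ### Stationary correlations -/

section Correlations

variable {p N : ℕ}

/-- The occupation variables, extended by the density `β` of the reservoir at the site `N`. -/
noncomputable def occExt (β : ℝ) (η : Config (sites p N)) (k : ℤ) : ℝ :=
  if k = N then β else occ η k

theorem occExt_of_lt (β : ℝ) (η : Config (sites p N)) {k : ℤ} (hk : k ≤ (N : ℤ) - 1) :
    occExt β η k = occ η k :=
  if_neg (by omega)

theorem occExt_self (β : ℝ) (η : Config (sites p N)) : occExt β η N = β :=
  if_pos rfl

theorem occ_replaceLeft (ξ : Config (leftSites p)) (η : Config (sites p N)) {k : ℤ}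
    (hk : 0 < k) : occ (replaceLeft ξ η) k = occ η k :=
  occ_congr (stateAt_replaceLeft_of_pos ξ η hk)

theorem leftGen_eq_zero (R : Config (leftSites p) → Config (leftSites p) → ℝ)
    {f : Config (sites p N) → ℝ} (hf : ∀ ξ η, f (replaceLeft ξ η) = f η)
    (η : Config (sites p N)) : leftGen N R f η = 0 :=
  Finset.sum_eq_zero fun ξ _ => by rw [hf, sub_self, mul_zero]

theorem occExt_swap_of_mem (β : ℝ) (η : Config (sites p N)) {a k : ℤ} (ha0 : 0 ≤ a)
    (ha : a ≤ (N : ℤ) - 2) (hk0 : 0 ≤ k) (hk : k ≤ (N : ℤ) - 1) :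
    occExt β η (Equiv.swap a (a + 1) k) = occ (exchange a (a + 1) η) k := by
  rw [occ_exchange _ (mem_sites ha0 (by omega)) (mem_sites (by omega) (by omega)), occExt_of_lt]
  exact (swap_succ_mem_Icc ha0 (by omega) hk0 hk).2

/-- The reservoir acts on the last occupation variable as an exchange with the site `N`. -/
theorem rightGen_mul_occ (hN : 1 ≤ N) (β : ℝ) {g : Config (sites p N) → ℝ}
    (hg : ∀ η, g (flipAt ((N : ℤ) - 1) η) = g η) {k : ℤ} (hk : k ≤ (N : ℤ) - 1)
    (η : Config (sites p N)) :
    rightGen β (fun η => g η * occ η k) η =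
      g η * (occExt β η (Equiv.swap ((N : ℤ) - 1) ((N : ℤ) - 1 + 1) k) - occExt β η k) := by
  rw [rightGen, hg, occExt_of_lt β η hk]
  rcases eq_or_ne k ((N : ℤ) - 1) with rfl | h
  · rw [Equiv.swap_apply_left, sub_add_cancel, occExt_self,
      occ_flipAt_self _ (mem_sites (by omega) le_rfl)]
    rcases occ_eq_zero_or_one η ((N : ℤ) - 1) with h | h <;> rw [h] <;> ring
  · rw [Equiv.swap_apply_of_ne_of_ne h (by omega), occExt_of_lt β η hk, occ_flipAt_of_ne _ h]
    ring

theorem sum_Icc_zero_split (hN : 1 ≤ N) (F : ℤ → ℝ) :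
    ∑ a ∈ Finset.Icc 0 ((N : ℤ) - 1), F a =
      ∑ a ∈ Finset.Icc 0 ((N : ℤ) - 2), F a + F ((N : ℤ) - 1) := by
  have h : Finset.Icc 0 ((N : ℤ) - 1) = insert ((N : ℤ) - 1) (Finset.Icc 0 ((N : ℤ) - 2)) := by
    ext k
    simp only [Finset.mem_insert, Finset.mem_Icc]
    omega
  rw [h, Finset.sum_insert (by rw [Finset.mem_Icc]; omega), add_comm]

/-- The left dynamics does not touch sites `k ≥ 1`, and the reservoir supplies the term `a = N - 1`.
The one-point equations thus close as those of a random walk on `{0, …, N}`, with none needed at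
site `0`. -/
theorem fullGen_occ (hN : 2 ≤ N) (R : Config (leftSites p) → Config (leftSites p) → ℝ)
    (l β : ℝ) {k : ℤ} (hk1 : 1 ≤ k) (hk : k ≤ (N : ℤ) - 1) (η : Config (sites p N)) :
    fullGen N R l β (fun η => occ η k) η =
      ∑ a ∈ Finset.Icc 0 ((N : ℤ) - 1),
        (occExt β η (Equiv.swap a (a + 1) k) - occExt β η k) := by
  rw [fullGen_eq hN, leftGen_eq_zero R (fun ξ η => occ_replaceLeft ξ η (by omega)), mul_zero,
    zero_add, sum_Icc_zero_split (by omega), stirGen]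
  congr 1
  · refine Finset.sum_congr rfl fun a ha => ?_
    rw [Finset.mem_Icc] at ha
    rw [occExt_swap_of_mem β η ha.1 ha.2 (by omega) hk, occExt_of_lt β η hk]
  · simpa using rightGen_mul_occ (by omega) β (g := fun _ => 1) (fun _ => rfl) hk η

/-- Since `j < k ≤ N - 1`, the factor at `j` is unaffected by the reservoir, so the two-point
equations close as for two exclusion particles. -/
theorem fullGen_occ_mul_occ (hN : 2 ≤ N) (R : Config (leftSites p) → Config (leftSites p) → ℝ)
    (l β : ℝ) {j k : ℤ} (hj : 1 ≤ j) (hjk : j < k) (hk : k ≤ (N : ℤ) - 1)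
    (η : Config (sites p N)) :
    fullGen N R l β (fun η => occ η j * occ η k) η =
      ∑ a ∈ Finset.Icc 0 ((N : ℤ) - 1),
        (occExt β η (Equiv.swap a (a + 1) j) * occExt β η (Equiv.swap a (a + 1) k) -
          occExt β η j * occExt β η k) := by
  rw [fullGen_eq hN, leftGen_eq_zero R fun ξ η => by
      rw [occ_replaceLeft ξ η (by omega), occ_replaceLeft ξ η (by omega)],
    mul_zero, zero_add, sum_Icc_zero_split (by omega), stirGen]
  congr 1
  · refine Finset.sum_congr rfl fun a ha => ?_
    rw [Finset.mem_Icc] at ha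
    rw [occExt_swap_of_mem β η ha.1 ha.2 (by omega) hk,
      occExt_swap_of_mem β η ha.1 ha.2 (by omega) (by omega), occExt_of_lt β η hk,
      occExt_of_lt β η (by omega)]
  · rw [rightGen_mul_occ (by omega) β (fun η => occ_flipAt_of_ne η (by omega)) hk,
      Equiv.swap_apply_of_ne_of_ne (x := j) (by omega) (by omega),
      occExt_of_lt β η (k := j) (by omega)]
    ring

variable {R : Config (leftSites p) → Config (leftSites p) → ℝ} {l β : ℝ}
  {ν : Config (sites p N) → ℝ}

/-- The stationary density profile is affine. -/
theorem IsStationary.density_eq (hN : 2 ≤ N) (hν : IsStationary (fullGen N R l β) ν) {k : ℕ}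
    (hk : k + 1 ≤ N) : density ν k = density ν 0 + (k / N) * (β - density ν 0) := by
  have h := eq_affine_of_discrete_harmonic (f := fun j => expect ν fun η => occExt β η j)
    (N := N) (by omega) (fun j hj1 hj => ?_) (k := k) (by omega)
  · simp only [occExt_self, expect_const hν.1] at h
    simpa only [density, occExt_of_lt β _ (show (k : ℤ) ≤ (N : ℤ) - 1 by omega),
      occExt_of_lt β _ (show (0 : ℤ) ≤ (N : ℤ) - 1 by omega)] using h
  · rw [← sum_swap_sub (fun j => expect ν fun η => occExt β η j) hj1 hj]
    have h0 := hν.2 fun η => occ η j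
    rw [funext (fullGen_occ hN R l β hj1 hj), expect_sum] at h0
    simpa only [expect_sub] using h0

/-- The truncated correlations are bounded above by their values at the left boundary. -/
theorem IsStationary.correlation_le (hN : 2 ≤ N) (hν : IsStationary (fullGen N R l β) ν)
    {c : ℝ} (hc : 0 ≤ c)
    (hleft : ∀ k : ℤ, 1 ≤ k → k ≤ (N : ℤ) - 1 →
      (expect ν fun η => occ η 0 * occ η k) - density ν 0 * density ν k ≤ c)
    {j k : ℤ} (hj : 0 ≤ j) (hjk : j < k) (hk : k ≤ (N : ℤ) - 1) :
    (expect ν fun η => occ η j * occ η k) - density ν j * density ν k ≤ c := by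
  set r : ℤ → ℝ := fun j => expect ν fun η => occExt β η j with hr
  set φ : ℤ → ℤ → ℝ := fun j k =>
    (expect ν fun η => occExt β η j * occExt β η k) - r j * r k with hφ
  have hφocc : ∀ j k : ℤ, j ≤ (N : ℤ) - 1 → k ≤ (N : ℤ) - 1 →
      φ j k = (expect ν fun η => occ η j * occ η k) - density ν j * density ν k := by
    intro j k hj hk
    simp only [hφ, hr, density, occExt_of_lt β _ hj, occExt_of_lt β _ hk]
  have hφN : ∀ j, φ j N = 0 := by
    intro j
    simp only [hφ, hr, occExt_self, expect_const hν.1, expect_mul_const, sub_self]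
  have hr0 : ∀ j : ℤ, 1 ≤ j → j ≤ (N : ℤ) - 1 →
      ∑ a ∈ Finset.Icc 0 ((N : ℤ) - 1), (r (Equiv.swap a (a + 1) j) - r j) = 0 := by
    intro j hj1 hj
    have h0 := hν.2 fun η => occ η j
    rw [funext (fullGen_occ hN R l β hj1 hj), expect_sum] at h0
    simpa only [expect_sub] using h0
  rw [← hφocc j k (by omega) hk]
  refine pair_maximum_principle (φ := φ) (n := N) (fun j k => ?_) (fun j k hj hjk hk => ?_)
    (fun k hk1 hk => ?_) (fun j _ _ => (hφN j).le.trans hc) hj hjk (by omega)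
  · simp only [hφ, mul_comm]
  · have h0 := hν.2 fun η => occ η j * occ η k
    rw [funext (fullGen_occ_mul_occ hN R l β hj hjk hk), expect_sum] at h0
    simp only [expect_sub] at h0
    have hprod : ∑ a ∈ Finset.Icc 0 ((N : ℤ) - 1),
        (r (Equiv.swap a (a + 1) j) * r (Equiv.swap a (a + 1) k) - r j * r k) ≤ 0 := by
      have hle : ∀ a : ℤ,
          r (Equiv.swap a (a + 1) j) * r (Equiv.swap a (a + 1) k) - r j * r k ≤
          (r (Equiv.swap a (a + 1) j) - r j) * r k +
            r j * (r (Equiv.swap a (a + 1) k) - r k) := by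
        intro a
        -- Both particles move only when they trade places, and then the cross term is `-(r (j + 1)
        -- - r j) ^ 2`. This sign makes the truncated correlations subharmonic.
        have hcross : (r (Equiv.swap a (a + 1) j) - r j) * (r (Equiv.swap a (a + 1) k) - r k) ≤ 0 := by
          by_cases hja : j = a ∧ k = a + 1
          · obtain ⟨rfl, rfl⟩ := hja
            rw [Equiv.swap_apply_left, Equiv.swap_apply_right]
            nlinarith [sq_nonneg (r (j + 1) - r j)]
          · by_cases hj' : j = a ∨ j = a + 1
            · rw [Equiv.swap_apply_of_ne_of_ne (x := k) (by omega) (by omega), sub_self, mul_zero]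
            · rw [Equiv.swap_apply_of_ne_of_ne (x := j) (by omega) (by omega), sub_self, zero_mul]
        nlinarith
      refine (Finset.sum_le_sum fun a _ => hle a).trans ?_
      rw [Finset.sum_add_distrib, ← Finset.sum_mul, ← Finset.mul_sum, hr0 j hj (by omega),
        hr0 k (by omega) hk]
      simp
    have hsplit : ∀ a : ℤ, φ (Equiv.swap a (a + 1) j) (Equiv.swap a (a + 1) k) - φ j k =
        ((expect ν fun η => occExt β η (Equiv.swap a (a + 1) j) *
            occExt β η (Equiv.swap a (a + 1) k)) -
          expect ν fun η => occExt β η j * occExt β η k) -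
        (r (Equiv.swap a (a + 1) j) * r (Equiv.swap a (a + 1) k) - r j * r k) := by
      intro a
      simp only [hφ]
      ring
    simp only [hsplit]
    rw [Finset.sum_sub_distrib, h0]
    linarith
  · rcases eq_or_ne k N with rfl | hkN
    · exact (hφN 0).le.trans hc
    · rw [hφocc 0 k (by omega) (by omega)]
      exact hleft k hk1 (by omega)

end Correlations

/-! ### The left boundary -/

/-- Averaging of the speeded up left boundary dynamics, tested against observables `g` of the
bulk which feel at most two bulk exchanges. -/
theorem exists_left_averaging_const {p : ℕ}
    {R : Config (leftSites p) → Config (leftSites p) → ℝ}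
    (hR : ∀ ξ ξ', ξ ≠ ξ' → 0 ≤ R ξ ξ') (hirr : IsIrreducibleChain R)
    {μ : Config (leftSites p) → ℝ} (hμ : IsStationary (chainGen R) μ) {β : ℝ}
    (hβ : β ∈ Set.Ioo (0 : ℝ) 1) :
    ∃ C, 0 ≤ C ∧ ∀ (N : ℕ) (l : ℝ) (ν : Config (sites p N) → ℝ), 2 ≤ N → 0 < l →
      IsStationary (fullGen N R l β) ν →
      ∀ (g : Config (sites p N) → ℝ) (T : Finset ℤ), (∀ η, |g η| ≤ 1) →
        (∀ ξ η, g (replaceLeft ξ η) = g η) → T.card ≤ 2 →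
        (∀ a, 1 ≤ a → a ≤ (N : ℤ) - 2 → a ∉ T → ∀ η, g (exchange a (a + 1) η) = g η) →
        |expect ν fun η => (occ η 0 - density μ 0) * g η| ≤ C / l := by
  obtain ⟨h, hh⟩ := hμ.exists_poisson (chainGen_isErgodicGenerator hR hirr) fun ξ => occ ξ 0
  set H : ℝ := ∑ ξ, |h ξ| with hH
  have hH0 : 0 ≤ H := Finset.sum_nonneg fun _ _ => abs_nonneg _
  have hhH : ∀ ξ, |h ξ| ≤ H := fun ξ =>
    Finset.single_le_sum (f := fun ξ => |h ξ|) (fun _ _ => abs_nonneg _) (Finset.mem_univ ξ)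
  -- At most three exchanges (the junction and those in `T`) and the reservoir flip each contribute
  -- at most `2 * H`.
  refine ⟨8 * H, by positivity, fun N l ν hN hl hν g T hg hgl hT hgT => ?_⟩
  set f : Config (sites p N) → ℝ := fun η => h (leftPart η) * g η with hf
  have hfH : ∀ η, |f η| ≤ H := fun η => by
    rw [hf, abs_mul]
    exact (mul_le_mul (hhH _) (hg η) (abs_nonneg _) hH0).trans_eq (mul_one H)
  have hdiff : ∀ η ζ, |f η - f ζ| ≤ 2 * H := fun η ζ => by
    linarith [abs_sub (f η) (f ζ), hfH η, hfH ζ]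
  have hleft : ∀ η, leftGen N R f η = (occ η 0 - density μ 0) * g η := by
    intro η
    have h1 : chainGen R h (leftPart η) = occ η 0 - density μ 0 := by
      rw [hh, density, ← occ_congr (stateAt_leftPart η le_rfl)]
    rw [← h1, leftGen, chainGen, Finset.sum_mul]
    refine Finset.sum_congr rfl fun ξ _ => ?_
    simp only [hf, hgl, leftPart_replaceLeft (show 1 ≤ N by omega)]
    ring
  have hstir : ∀ η, |stirGen f η| ≤ 6 * H := by
    intro η
    calc |stirGen f η|
        ≤ ∑ a ∈ Finset.Icc (0 : ℤ) ((N : ℤ) - 2), |f (exchange a (a + 1) η) - f η| :=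
          Finset.abs_sum_le_sum_abs _ _
      -- The bond `0` is added to `T` because the junction exchange changes the left part, hence
      -- `h`.
      _ ≤ ∑ a ∈ Finset.Icc (0 : ℤ) ((N : ℤ) - 2), if a ∈ insert 0 T then 2 * H else 0 := by
          refine Finset.sum_le_sum fun a ha => ?_
          rw [Finset.mem_Icc] at ha
          split_ifs with haT
          · exact hdiff _ _
          · rw [Finset.mem_insert, not_or] at haT
            simp only [hf]
            rw [hgT a (by omega) ha.2 haT.2,
              leftPart_exchange (by omega) (by omega) (by omega) (by omega), sub_self, abs_zero]
      _ ≤ ∑ a ∈ insert 0 T, 2 * H := by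
          rw [← Finset.sum_filter]
          exact Finset.sum_le_sum_of_subset_of_nonneg
            (fun a ha => (Finset.mem_filter.1 ha).2) fun _ _ _ => by positivity
      _ ≤ 6 * H := by
          rw [Finset.sum_const, nsmul_eq_mul]
          have : ((insert 0 T).card : ℝ) ≤ 3 := by
            exact_mod_cast (Finset.card_insert_le 0 T).trans (by omega)
          nlinarith
  have hright : ∀ η, |rightGen β f η| ≤ 2 * H := by
    intro η
    rw [rightGen, abs_mul, abs_of_pos (rightRate_pos hβ η _)]
    exact (mul_le_mul (rightRate_le_one hβ η _) (hdiff _ _) (abs_nonneg _) zero_le_one).trans_eq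
      (one_mul _)
  have hstat := hν.2 f
  have hgen : fullGen N R l β f = fun η =>
      l * ((occ η 0 - density μ 0) * g η) + (stirGen f η + rightGen β f η) := by
    funext η
    rw [fullGen_eq hN, hleft, add_assoc]
  rw [hgen, expect_add, expect_const_mul] at hstat
  have hrest : |expect ν fun η => stirGen f η + rightGen β f η| ≤ 8 * H :=
    abs_expect_le hν.1 fun η => by
      linarith [abs_add_le (stirGen f η) (rightGen β f η), hstir η, hright η]
  rw [le_div_iff₀' hl]
  nth_rw 1 [← abs_of_pos hl]
  rw [← abs_mul, eq_neg_of_add_eq_zero_left hstat, abs_neg]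
  exact hrest

theorem density_mem_Icc {Λ : Finset ℤ} {ν : Config Λ → ℝ} (hν : ν ∈ stdSimplex ℝ (Config Λ))
    (k : ℤ) : density ν k ∈ Set.Icc (0 : ℝ) 1 := by
  constructor
  · rw [← expect_const hν 0]
    exact expect_mono hν fun η => occ_nonneg η k
  · rw [← expect_const hν 1]
    exact expect_mono hν fun η => occ_le_one η k

/-- Up to a constant, both the density at the site `0` and the truncated correlations are
controlled by the inverse of the speed of the left boundary. -/
theorem exists_boundary_const {p : ℕ}
    {R : Config (leftSites p) → Config (leftSites p) → ℝ}
    (hR : ∀ ξ ξ', ξ ≠ ξ' → 0 ≤ R ξ ξ') (hirr : IsIrreducibleChain R)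
    {μ : Config (leftSites p) → ℝ} (hμ : IsStationary (chainGen R) μ) {β : ℝ}
    (hβ : β ∈ Set.Ioo (0 : ℝ) 1) :
    ∃ C, 0 ≤ C ∧ ∀ (N : ℕ) (l : ℝ) (ν : Config (sites p N) → ℝ), 2 ≤ N → 0 < l →
      IsStationary (fullGen N R l β) ν →
      |density ν 0 - density μ 0| ≤ C / l ∧
      ∀ j k : ℤ, 0 ≤ j → j < k → k ≤ (N : ℤ) - 1 →
        (expect ν fun η => occ η j * occ η k) - density ν j * density ν k ≤ 2 * C / l := by
  obtain ⟨C, hC, h⟩ := exists_left_averaging_const hR hirr hμ hβ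
  refine ⟨C, hC, fun N l ν hN hl hν => ?_⟩
  have h0 : |density ν 0 - density μ 0| ≤ C / l := by
    have := h N l ν hN hl hν (fun _ => 1) ∅ (by simp) (by simp) (by simp) (by simp)
    simp only [mul_one, expect_sub, expect_const hν.1] at this
    exact this
  refine ⟨h0, fun j k => hν.correlation_le hN (by positivity) fun k hk1 hk => ?_⟩
  -- The bonds `k - 1` and `k` are the only ones touching site `k`.
  have h1 := h N l ν hN hl hν (fun η => occ η k) {k - 1, k}
    (fun η => abs_le.2 ⟨by linarith [occ_nonneg η k], occ_le_one η k⟩)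
    (fun ξ η => occ_replaceLeft ξ η (by omega)) Finset.card_le_two
    (fun a ha1 ha haT η => by
      simp only [Finset.mem_insert, Finset.mem_singleton, not_or] at haT
      rw [occ_exchange _ (mem_sites (by omega) (by omega)) (mem_sites (by omega) (by omega)),
        Equiv.swap_apply_of_ne_of_ne (by omega) (by omega)])
  simp only [sub_mul, expect_sub, expect_const_mul] at h1
  change |_ - density μ 0 * density ν k| ≤ _ at h1
  obtain ⟨hk0, hk1'⟩ := density_mem_Icc hν.1 k
  -- Replacing `ρ(0)` by `ρ_N(0)` in the product costs a second `C / l`, whence the factor `2`.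
  have h2 : (density μ 0 - density ν 0) * density ν k ≤ C / l := by
    have h3 := (abs_le.1 h0).1
    have h4 : 0 ≤ C / l := by positivity
    nlinarith
  have h5 := (abs_le.1 h1).2
  rw [mul_div_assoc]
  linarith

/-! ### The hydrostatic limit -/

/-- The law of large numbers for a nonnegative weight, from an upper bound on the truncated
correlations. -/
theorem expect_abs_weighted_sum_le {Λ : Finset ℤ} {ν : Config Λ → ℝ}
    (hν : ν ∈ stdSimplex ℝ (Config Λ)) {N : ℕ} {c M : ℝ} (hc : 0 ≤ c)
    {w : ℕ → ℝ} (hw : ∀ k ∈ Finset.Ico 1 N, 0 ≤ w k ∧ w k ≤ M)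
    (hcorr : ∀ j ∈ Finset.Ico 1 N, ∀ k ∈ Finset.Ico 1 N, j ≠ k →
      (expect ν fun η => occ η j * occ η k) - density ν j * density ν k ≤ c) :
    (expect ν fun η => |(1 / (N : ℝ)) * ∑ k ∈ Finset.Ico 1 N, w k * (occ η k - density ν k)|) ≤
      √(M ^ 2 * (c + 1 / N)) := by
  refine (expect_abs_sq_le hν _).trans (Real.sqrt_le_sqrt ?_)
  rcases Nat.eq_zero_or_pos N with rfl | hN
  · simp [expect]
    positivity
  -- The diagonal terms are variances of `{0, 1}`-valued variables, at most `1`; they produce the `1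
  -- / N`.
  have hcov : ∀ j ∈ Finset.Ico 1 N, ∀ k ∈ Finset.Ico 1 N,
      (expect ν fun η => (occ η j - density ν j) * (occ η k - density ν k)) ≤
        c + if j = k then 1 else 0 := by
    intro j hj k hk
    have hexp : (expect ν fun η => (occ η j - density ν j) * (occ η k - density ν k)) =
        (expect ν fun η => occ η j * occ η k) - density ν j * density ν k := by
      have h1 : (fun η : Config Λ => (occ η j - density ν j) * (occ η k - density ν k)) =
          fun η => ((occ η j * occ η k - density ν j * occ η k) - occ η j * density ν k) +
            density ν j * density ν k := by
        funext η
        ring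
      rw [h1, expect_add, expect_sub, expect_sub, expect_const_mul, expect_mul_const,
        expect_const hν]
      simp only [density]
      ring
    rw [hexp]
    split_ifs with hjk
    · subst hjk
      simp only [occ_mul_self]
      have := (density_mem_Icc hν (j : ℤ)).2
      have h2 : (expect ν fun η => occ η (j : ℤ)) = density ν j := rfl
      rw [h2]
      nlinarith [mul_self_nonneg (density ν (j : ℤ))]
    · rw [add_zero]
      exact hcorr j hj k hk hjk
  have hsq : (fun η : Config Λ =>
      ((1 / (N : ℝ)) * ∑ k ∈ Finset.Ico 1 N, w k * (occ η k - density ν k)) ^ 2) = fun η =>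
      (1 / (N : ℝ)) ^ 2 * ∑ j ∈ Finset.Ico 1 N, ∑ k ∈ Finset.Ico 1 N,
        (w j * w k) * ((occ η j - density ν j) * (occ η k - density ν k)) := by
    funext η
    rw [mul_pow, sq (∑ k ∈ _, _), Finset.sum_mul_sum]
    congr 1
    exact Finset.sum_congr rfl fun j _ => Finset.sum_congr rfl fun k _ => by ring
  rw [hsq, expect_const_mul, expect_sum]
  simp only [expect_sum, expect_const_mul]
  have hbound : ∑ j ∈ Finset.Ico 1 N, ∑ k ∈ Finset.Ico 1 N, (w j * w k) *
        (expect ν fun η => (occ η j - density ν j) * (occ η k - density ν k)) ≤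
      M ^ 2 * (N ^ 2 * c + N) := by
    calc _ ≤ ∑ j ∈ Finset.Ico 1 N, ∑ k ∈ Finset.Ico 1 N,
          M ^ 2 * (c + if j = k then (1 : ℝ) else 0) := by
          refine Finset.sum_le_sum fun j hj => Finset.sum_le_sum fun k hk => ?_
          have h1 : w j * w k ≤ M ^ 2 := by
            rw [sq]
            exact mul_le_mul (hw j hj).2 (hw k hk).2 (hw k hk).1 ((hw j hj).1.trans (hw j hj).2)
          -- Nonnegativity of the weights is essential here: the covariances are bounded only from
          -- above.
          refine (mul_le_mul_of_nonneg_left (hcov j hj k hk)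
            (mul_nonneg (hw j hj).1 (hw k hk).1)).trans (mul_le_mul_of_nonneg_right h1 ?_)
          split_ifs <;> positivity
      _ = M ^ 2 * (((N - 1 : ℕ) : ℝ) ^ 2 * c + (N - 1 : ℕ)) := by
          simp only [← Finset.mul_sum, Finset.sum_add_distrib, Finset.sum_const, Nat.card_Ico,
            nsmul_eq_mul, Finset.sum_ite_eq]
          rw [Finset.sum_congr rfl fun j hj => if_pos hj, Finset.sum_const, Nat.card_Ico,
            nsmul_eq_mul]
          ring
      _ ≤ M ^ 2 * (N ^ 2 * c + N) := by
          have : ((N - 1 : ℕ) : ℝ) ≤ N := by exact_mod_cast Nat.sub_le N 1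
          gcongr
  calc _ ≤ (1 / (N : ℝ)) ^ 2 * (M ^ 2 * (N ^ 2 * c + N)) := by gcongr
    _ = M ^ 2 * (c + 1 / N) := by
      field_simp

/-- The quantitative form of the hydrostatic limit. -/
theorem IsStationary.expect_abs_le {p N : ℕ}
    {R : Config (leftSites p) → Config (leftSites p) → ℝ} {l β r : ℝ}
    {ν : Config (sites p N) → ℝ} (hN : 2 ≤ N) (hν : IsStationary (fullGen N R l β) ν)
    {c : ℝ} (hc : 0 ≤ c) (h0 : |density ν 0 - r| ≤ c)
    (hcorr : ∀ j k : ℤ, 0 ≤ j → j < k → k ≤ (N : ℤ) - 1 →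
      (expect ν fun η => occ η j * occ η k) - density ν j * density ν k ≤ c)
    {G : ℝ → ℝ} {M : ℝ} (hM : ∀ x ∈ Set.Icc (0 : ℝ) 1, |G x| ≤ M) :
    (expect ν fun η => |(1 / (N : ℝ)) * ∑ k ∈ Finset.Ico 1 N,
      G ((k : ℝ) / N) * (occ η (k : ℤ) - (r + (β - r) * ((k : ℝ) / N)))|) ≤
      2 * √(M ^ 2 * (c + 1 / N)) + M * c := by
  have hNpos : (0 : ℝ) < N := by positivity
  have hM0 : 0 ≤ M := (abs_nonneg _).trans (hM 0 (by simp))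
  have hmem : ∀ k ∈ Finset.Ico 1 N, (k : ℝ) / N ∈ Set.Icc (0 : ℝ) 1 := by
    intro k hk
    have h1 : (k : ℝ) ≤ N := by exact_mod_cast (Finset.mem_Ico.1 hk).2.le
    exact ⟨by positivity, (div_le_one hNpos).2 h1⟩
  have hcorr' : ∀ j ∈ Finset.Ico 1 N, ∀ k ∈ Finset.Ico 1 N, j ≠ k →
      (expect ν fun η => occ η j * occ η k) - density ν j * density ν k ≤ c := by
    intro j hj k hk hjk
    rw [Finset.mem_Ico] at hj hk
    rcases lt_or_gt_of_ne hjk with h | h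
    · exact hcorr j k (by omega) (by omega) (by omega)
    · have := hcorr k j (by omega) (by omega) (by omega)
      simpa only [mul_comm] using this
  set Gp : ℕ → ℝ := fun k => max (G ((k : ℝ) / N)) 0 with hGp
  set Gm : ℕ → ℝ := fun k => max (-G ((k : ℝ) / N)) 0 with hGm
  have hp := expect_abs_weighted_sum_le hν.1 hc (w := Gp) (M := M)
    (fun k hk => ⟨le_max_right _ _, max_le ((le_abs_self _).trans (hM _ (hmem k hk))) hM0⟩) hcorr'
  have hm := expect_abs_weighted_sum_le hν.1 hc (w := Gm) (M := M)
    (fun k hk => ⟨le_max_right _ _, max_le ((neg_le_abs _).trans (hM _ (hmem k hk))) hM0⟩) hcorr'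
  -- Both profiles are affine with the same value `β` at `N`, so their difference is the discrepancy
  -- at `0` times `1 - k / N`.
  have hbias : ∀ k ∈ Finset.Ico 1 N,
      |G ((k : ℝ) / N) * (density ν k - (r + (β - r) * ((k : ℝ) / N)))| ≤ M * c := by
    intro k hk
    have h1 : density ν k - (r + (β - r) * ((k : ℝ) / N)) =
        (density ν 0 - r) * (1 - (k : ℝ) / N) := by
      rw [hν.density_eq hN (Finset.mem_Ico.1 hk).2]
      ring
    obtain ⟨h2, h3⟩ := hmem k hk
    rw [h1, abs_mul, abs_mul, abs_of_nonneg (sub_nonneg.2 h3)]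
    refine mul_le_mul (hM _ (hmem k hk)) ?_ (mul_nonneg (abs_nonneg _) (sub_nonneg.2 h3)) hM0
    exact (mul_le_of_le_one_right (abs_nonneg _) (by linarith)).trans h0
  have hbiasSum : |(1 / (N : ℝ)) * ∑ k ∈ Finset.Ico 1 N,
      G ((k : ℝ) / N) * (density ν k - (r + (β - r) * ((k : ℝ) / N)))| ≤ M * c := by
    rw [abs_mul, abs_of_pos (by positivity), one_div, inv_mul_le_iff₀ hNpos]
    refine (Finset.abs_sum_le_sum_abs _ _).trans ((Finset.sum_le_sum hbias).trans ?_)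
    rw [Finset.sum_const, Nat.card_Ico, nsmul_eq_mul]
    have : ((N - 1 : ℕ) : ℝ) ≤ N := by exact_mod_cast Nat.sub_le N 1
    gcongr
  have hpoint : ∀ η : Config (sites p N),
      |(1 / (N : ℝ)) * ∑ k ∈ Finset.Ico 1 N,
        G ((k : ℝ) / N) * (occ η (k : ℤ) - (r + (β - r) * ((k : ℝ) / N)))| ≤
      (|(1 / (N : ℝ)) * ∑ k ∈ Finset.Ico 1 N, Gp k * (occ η k - density ν k)| +
        |(1 / (N : ℝ)) * ∑ k ∈ Finset.Ico 1 N, Gm k * (occ η k - density ν k)|) + M * c := by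
    intro η
    have hsplit : (1 / (N : ℝ)) * ∑ k ∈ Finset.Ico 1 N,
          G ((k : ℝ) / N) * (occ η (k : ℤ) - (r + (β - r) * ((k : ℝ) / N))) =
        ((1 / (N : ℝ)) * ∑ k ∈ Finset.Ico 1 N, Gp k * (occ η k - density ν k) -
          (1 / (N : ℝ)) * ∑ k ∈ Finset.Ico 1 N, Gm k * (occ η k - density ν k)) +
        (1 / (N : ℝ)) * ∑ k ∈ Finset.Ico 1 N,
          G ((k : ℝ) / N) * (density ν k - (r + (β - r) * ((k : ℝ) / N))) := by
      rw [← mul_sub, ← mul_add, ← Finset.sum_sub_distrib, ← Finset.sum_add_distrib]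
      congr 1
      refine Finset.sum_congr rfl fun k _ => ?_
      have : G ((k : ℝ) / N) = Gp k - Gm k := by
        rcases le_total 0 (G ((k : ℝ) / N)) with h | h <;> simp [hGp, hGm, h]
      rw [← sub_mul, ← this]
      ring
    rw [hsplit]
    exact (abs_add_le _ _).trans (add_le_add (abs_sub _ _) hbiasSum)
  refine (expect_mono hν.1 hpoint).trans ?_
  rw [expect_add, expect_add, expect_const hν.1]
  linarith

end BoundaryExclusion

theorem theorem2p3 (p : ℕ)
    (R : Config (leftSites p) → Config (leftSites p) → ℝ)
    (hR : ∀ ξ ξ', ξ ≠ ξ' → 0 ≤ R ξ ξ')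
    (hirr : IsIrreducibleChain R)
    (β : ℝ) (hβ : β ∈ Set.Ioo (0 : ℝ) 1)
    (ℓ : ℕ → ℝ) (hℓpos : ∀ N, 2 ≤ N → 0 < ℓ N) (hℓ : Tendsto ℓ atTop atTop) :
    (∃! μ, IsStationary (chainGen R) μ) ∧
    (∀ N, 2 ≤ N → ∃! μN, IsStationary (fullGen N R (ℓ N) β) μN) ∧
    ∀ (μ : Config (leftSites p) → ℝ) (μN : ∀ N : ℕ, Config (sites p N) → ℝ),
      IsStationary (chainGen R) μ →
      (∀ N, 2 ≤ N → IsStationary (fullGen N R (ℓ N) β) (μN N)) →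
      (∃ C₀ : ℝ, ∀ N, 2 ≤ N →
        |density (μN N) 0 - density μ 0| ≤ C₀ / Real.sqrt (ℓ N)) ∧
      ∃ u : ℝ → ℝ, SolvesDirichlet (density μ 0) β u ∧
        (∀ v : ℝ → ℝ, SolvesDirichlet (density μ 0) β v → Set.EqOn v u (Set.Icc 0 1)) ∧
        ∀ G : ℝ → ℝ, ContinuousOn G (Set.Icc 0 1) →
          Tendsto (fun N : ℕ => expect (μN N) fun η =>
              |(1 / (N : ℝ)) * ∑ k ∈ Finset.Ico 1 N,
                G ((k : ℝ) / N) * (occ η (k : ℤ) - u ((k : ℝ) / N))|)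
            atTop (𝓝 0) := by
  refine ⟨(chainGen_isErgodicGenerator hR hirr).existsUnique_stationary,
    fun N hN => (fullGen_isErgodicGenerator hN hR hirr (hℓpos N hN) hβ).existsUnique_stationary,
    fun μ μN hμ hμN => ?_⟩
  obtain ⟨C, hC, h⟩ := exists_boundary_const hR hirr hμ hβ
  -- For `ℓ N ≥ 1` the bound `C / ℓ N` is stronger than required; for `ℓ N ≤ 1` it suffices that
  -- both densities lie in `[0, 1]`, whence the `1`.
  refine ⟨⟨max C 1, fun N hN => ?_⟩, _, solvesDirichlet_affine _ _,
    fun v hv => hv.eqOn_affine, fun G hG => ?_⟩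
  · have hl := hℓpos N hN
    have hs := Real.sqrt_pos.2 hl
    rw [le_div_iff₀ hs]
    rcases le_total 1 (ℓ N) with h1 | h1
    · have hle : √(ℓ N) ≤ ℓ N := Real.sqrt_le_iff.2 ⟨hl.le, by nlinarith⟩
      calc _ ≤ C / ℓ N * ℓ N :=
            mul_le_mul (h N _ _ hN hl (hμN N hN)).1 hle hs.le (by positivity)
        _ = C := div_mul_cancel₀ _ hl.ne'
        _ ≤ _ := le_max_left _ _
    · have hle : √(ℓ N) ≤ 1 := Real.sqrt_le_one.2 h1
      obtain ⟨a0, a1⟩ := density_mem_Icc (hμN N hN).1 0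
      obtain ⟨b0, b1⟩ := density_mem_Icc hμ.1 0
      have habs : |density (μN N) 0 - density μ 0| ≤ 1 := abs_le.2 ⟨by linarith, by linarith⟩
      exact (mul_le_one₀ habs hs.le hle).trans (le_max_right _ _)
  · obtain ⟨M, hM⟩ := isCompact_Icc.exists_bound_of_continuousOn hG
    have hinv : Tendsto (fun N => (ℓ N)⁻¹) atTop (𝓝 0) := tendsto_inv_atTop_zero.comp hℓ
    have hc : Tendsto (fun N => 2 * C / ℓ N) atTop (𝓝 0) := by
      simpa [div_eq_mul_inv] using hinv.const_mul (2 * C)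
    have hlim : Tendsto (fun N : ℕ => 2 * √(M ^ 2 * (2 * C / ℓ N + 1 / N)) + M * (2 * C / ℓ N))
        atTop (𝓝 0) := by
      have h1 := ((hc.add tendsto_one_div_atTop_nhds_zero_nat).const_mul (M ^ 2)).sqrt
      simpa using (h1.const_mul 2).add (hc.const_mul M)
    refine tendsto_of_tendsto_of_tendsto_of_le_of_le' tendsto_const_nhds hlim ?_ ?_
    · filter_upwards [eventually_ge_atTop 2] with N hN
      rw [← expect_const (hμN N hN).1 0]
      exact expect_mono (hμN N hN).1 fun η => abs_nonneg _
    · filter_upwards [eventually_ge_atTop 2] with N hN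
      have hl := hℓpos N hN
      obtain ⟨h0, hcorr⟩ := h N _ _ hN hl (hμN N hN)
      -- The density error `C / ℓ N` is relaxed to `2 * C / ℓ N`, the common bound shared with the
      -- correlations.
      refine (hμN N hN).expect_abs_le hN (by positivity) (h0.trans ?_) hcorr hM
      gcongr
      linarith
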